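/- Let $(\Omega,\Sigma,\mu)$ be a complete, strictly localizable measure space, i.e. $\Omega$ is partitioned into measurable sets $A_\alpha$ of finite measure such that a set $B$ is measurable whenever all $B\cap A_\alpha$ are, and $\mu(B)=\sum_\alpha\mu(B\cap A_\alpha)$ for measurable $B$. Let $p\in[1,\infty]$ and let $F$ be a real Banach lattice with dual $F'$; let $F'_+$ be the set of functionals $\varphi \in F'$ with $\varphi(v)\ge 0$ for all $v\in F$, $v \ge 0$. Identify $\mathscr{L}(F')$ with the dual of the completed projective tensor product $F'\tilde\otimes_\pi F$ via $\langle S, v'\otimes v\rangle=\langle Sv',v\rangle$. Let $\mathcal{L}_{\sigma^*}(\Omega;\mathscr{L}(F'))$ be the set of functions $M\colon\Omega\to\mathscr{L}(F')$ such that $\langle M(\cdot),u\rangle$ is measurable for every $u\in F'\tilde\otimes_\pi F$ and $\|M\|_{\sigma^*}=\sup_{\|u\|\le 1}\operatorname{ess\,sup}_{\omega}|\langle M(\omega),u\rangle|<\infty$, and let $L^\infty_{\sigma^*}(\Omega;\mathscr{L}(F'))$ be its quotient by the relation $\|M-N\|_{\sigma^*}=0$. The class of $M$ is called positive if it has a representative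 $N$ such that, for every $\omega \in \Omega$, $N(\omega)$ maps $F'_+$ into $F'_+$. An operator $T$ on $L^p(\Omega;F')$ is called positive if $f(\omega)\in F'_+$ for almost every $\omega$ implies $(Tf)(\omega)\in F'_+$ for almost every $\omega$. Let $T\in\mathscr{L}(L^p(\Omega;F'))$ be local, i.e. for every $f$, $Tf=0$ almost everywhere on $\{f=0\}$, and let $M\in L^\infty_{\sigma^*}(\Omega;\mathscr{L}(F'))$ be a multiplier of $T$, i.e. $T=\mathcal{M}_M$ with $(\mathcal{M}_Mf)(\omega)=M(\omega)f(\omega)$, in the sense that for all $f\in L^p(\Omega;F')$ and $v\in F$ one has $\langle (Tf)(\omega),v\rangle=\langle M(\omega)f(\omega),v\rangle$ for almost every $\omega$ (this does not depend on the representative of $M$, and it holds in particular if $(Tf)(\omega)=M(\omega)f(\omega)$ almost everywhere for every $f$). Then $T$ is positive if and only if $M$ is positive. -/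

import Mathlib

set_option maxSynthPendingDepth 3

open MeasureTheory Set
open scoped ENNReal

/-- `(Ω, μ)` is strictly localizable: `Ω` is partitioned into measurable sets of finite measure such
that a set is measurable as soon as all its traces on the pieces are, and the measure of a
measurable set is the (unordered, possibly uncountable) sum of the measures of its traces. -/
def IsStrictlyLocalizable {Ω : Type*} [MeasurableSpace Ω] (μ : Measure Ω) : Prop :=
  ∃ 𝒜 : Set (Set Ω),
    (∀ A ∈ 𝒜, MeasurableSet A ∧ μ A < ∞) ∧
    𝒜.PairwiseDisjoint id ∧
    ⋃₀ 𝒜 = univ ∧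
    (∀ B : Set Ω, (∀ A ∈ 𝒜, MeasurableSet (B ∩ A)) → MeasurableSet B) ∧
    (∀ B : Set Ω, MeasurableSet B → μ B = ∑' A : 𝒜, μ (B ∩ (A : Set Ω)))

section SigmaStar

variable {Ω X : Type*} [MeasurableSpace Ω] [NormedAddCommGroup X] [NormedSpace ℝ X]

/-- The seminorm `‖f‖_{σ*} = sup_{u ∈ B_P} ess sup_ω |⟨f ω, u⟩|` of a function `f` with values in a
dual Banach space `X`, whose predual is given as a closed subspace `P` of the dual of `X`
(the image of the predual under the canonical isometry into its bidual `X'`). -/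
noncomputable def sigmaStarNorm (P : Submodule ℝ (StrongDual ℝ X)) (μ : Measure Ω)
    (f : Ω → X) : ℝ≥0∞ :=
  ⨆ u : {u : StrongDual ℝ X // u ∈ P ∧ ‖u‖ ≤ 1}, essSup (fun ω => ‖u.1 (f ω)‖ₑ) μ

/-- Membership in `𝓛_{σ*}(Ω; X)`: `f` is `σ(X, P)`-measurable and `σ(X, P)`-bounded. -/
structure MemSigmaStar (P : Submodule ℝ (StrongDual ℝ X)) (μ : Measure Ω) (f : Ω → X) : Prop where
  measurable : ∀ u ∈ P, Measurable fun ω => u (f ω)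
  bounded : sigmaStarNorm P μ f < ∞

/-- `f ~ g`: the functions represent the same element of `L^∞_{σ*}(Ω; X)`. -/
def SigmaStarEquiv (P : Submodule ℝ (StrongDual ℝ X)) (μ : Measure Ω) (f g : Ω → X) : Prop :=
  sigmaStarNorm P μ (fun ω => f ω - g ω) = 0

end SigmaStar

section Multipliers

variable {F : Type*} [NormedAddCommGroup F] [NormedSpace ℝ F]

/-- The simple tensor `v' ⊗ v` of `F' ⊗ F`, acting on `S ∈ 𝓛(F')` by `⟨S, v' ⊗ v⟩ = ⟨S v', v⟩`. -/
noncomputable def simpleTensor (v' : StrongDual ℝ F) (v : F) :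
    StrongDual ℝ (StrongDual ℝ F →L[ℝ] StrongDual ℝ F) :=
  (ContinuousLinearMap.apply ℝ ℝ v).comp
    (ContinuousLinearMap.apply ℝ (StrongDual ℝ F) v')

@[simp]
theorem simpleTensor_apply (v' : StrongDual ℝ F) (v : F)
    (S : StrongDual ℝ F →L[ℝ] StrongDual ℝ F) : simpleTensor v' v S = S v' v := rfl

variable (F) in
/-- The completed projective tensor product of `F'` and `F`, the predual of `𝓛(F')`. The dual of
the projective tensor product is `𝓛(F')` under `⟨S, v' ⊗ v⟩ = ⟨S v', v⟩`, so the projective tensor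
product embeds isometrically into its bidual, the dual of `𝓛(F')`; its image is the closed linear
span of the simple tensors, and the projective norm is the norm induced from there. -/
noncomputable def projTensor :
    Submodule ℝ (StrongDual ℝ (StrongDual ℝ F →L[ℝ] StrongDual ℝ F)) :=
  (Submodule.span ℝ {u | ∃ (v' : StrongDual ℝ F) (v : F), u = simpleTensor v' v}).topologicalClosure

variable {Ω : Type*} [MeasurableSpace Ω]

/-- An operator `T` on `L^p(Ω; E)` is local: `T f = 0` a.e. on `{f = 0}`. -/
def IsLocalOperator {E : Type*} [NormedAddCommGroup E] [NormedSpace ℝ E] {μ : Measure Ω} {p : ℝ≥0∞}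
    [Fact (1 ≤ p)] (T : Lp E p μ →L[ℝ] Lp E p μ) : Prop :=
  ∀ f : Lp E p μ, ∀ᵐ ω ∂μ, f ω = 0 → T f ω = 0

/-- `T = 𝓜_M` on `L^p(Ω; F')`, where `(𝓜_M f)(ω) = M(ω) f(ω)`. As for all functions obtained from
elements of `L^∞_{σ*}`, the two sides are compared after pairing with each `v ∈ F`, the null set
being allowed to depend on `v`; so the notion does not depend on the representative of `M`. -/
def IsMultiplicationOperator {μ : Measure Ω} {p : ℝ≥0∞} [Fact (1 ≤ p)]
    (M : Ω → StrongDual ℝ F →L[ℝ] StrongDual ℝ F)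
    (T : Lp (StrongDual ℝ F) p μ →L[ℝ] Lp (StrongDual ℝ F) p μ) : Prop :=
  ∀ (f : Lp (StrongDual ℝ F) p μ) (v : F), ∀ᵐ ω ∂μ, T f ω v = M ω (f ω) v

/-- In particular `T = 𝓜_M` if `(T f)(ω) = M(ω) f(ω)` in `F'` for almost every `ω`. -/
theorem IsMultiplicationOperator.of_ae {μ : Measure Ω} {p : ℝ≥0∞} [Fact (1 ≤ p)]
    {M : Ω → StrongDual ℝ F →L[ℝ] StrongDual ℝ F}
    {T : Lp (StrongDual ℝ F) p μ →L[ℝ] Lp (StrongDual ℝ F) p μ}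
    (h : ∀ f : Lp (StrongDual ℝ F) p μ, ∀ᵐ ω ∂μ, T f ω = M ω (f ω)) :
    IsMultiplicationOperator M T := by
  intro f v
  filter_upwards [h f] with ω hω
  rw [hω]

variable [Lattice F]

/-- The cone `F'_+` of positive functionals. -/
def IsPositiveFunctional (φ : StrongDual ℝ F) : Prop := ∀ v : F, 0 ≤ v → 0 ≤ φ v

/-- Positive operators on `F'`. -/
def IsPositiveOperator (S : StrongDual ℝ F →L[ℝ] StrongDual ℝ F) : Prop :=
  ∀ φ : StrongDual ℝ F, IsPositiveFunctional φ → IsPositiveFunctional (S φ)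

/-- Positive operators on `L^p(Ω; F')`, where `f ≥ 0` means `f(ω) ∈ F'_+` for a.e. `ω`. -/
def IsPositiveLpOperator {μ : Measure Ω} {p : ℝ≥0∞} [Fact (1 ≤ p)]
    (T : Lp (StrongDual ℝ F) p μ →L[ℝ] Lp (StrongDual ℝ F) p μ) : Prop :=
  ∀ f : Lp (StrongDual ℝ F) p μ, (∀ᵐ ω ∂μ, IsPositiveFunctional (f ω)) →
    ∀ᵐ ω ∂μ, IsPositiveFunctional (T f ω)

/-- The class of `M` in `L^∞_{σ*}(Ω; 𝓛(F'))` is positive: it has a representative all of whose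
values are positive operators. -/
def IsPositiveMultiplier (μ : Measure Ω) (M : Ω → StrongDual ℝ F →L[ℝ] StrongDual ℝ F) : Prop :=
  ∃ N : Ω → StrongDual ℝ F →L[ℝ] StrongDual ℝ F,
    MemSigmaStar (projTensor F) μ N ∧ SigmaStarEquiv (projTensor F) μ N M ∧
      ∀ ω, IsPositiveOperator (N ω)

end Multipliers

/-! If `N` is a representative with positive values, then `T f` paired with `v ≥ 0` is a.e. `N ω (f
ω) v ≥ 0`. The null set depends on `v`, but `T f` is essentially separably valued, so countably many
`v` decide positivity (`ae_isPositiveFunctional`).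

Conversely, testing `T` on `φ · 1_A` with `A` of finite measure gives `M ω φ v ≥ 0` a.e. for each
fixed pair of positive `φ`, `v`. Uncountably many null sets remain. A linear lifting `ρ`, choosing
representatives linearly and positively, removes them: `N ω φ v = ρ (M · φ v) ω` is bilinear and
bounded, positive at every `ω`, and a.e. equal to `M ω φ v`.

For finite measures, `ρ` comes from Zorn's lemma on liftings over sub-σ-algebras: martingale
convergence bounds chains with a cofinal sequence, unions bound the others, and one more set can
always be adjoined. Only linearity and positivity are asked of `ρ`, so conditional expectations may
be used throughout. Liftings on the pieces are then glued. -/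

/-- `f` is bounded outside a null set. -/
def EssBounded {Ω : Type*} [MeasurableSpace Ω] (μ : Measure Ω) (f : Ω → ℝ) : Prop :=
  ∃ C : ℝ, ∀ᵐ ω ∂μ, |f ω| ≤ C

namespace EssBounded

variable {Ω : Type*} {m m0 : MeasurableSpace Ω} {μ : Measure Ω} {f g : Ω → ℝ}

theorem add (hf : EssBounded μ f) (hg : EssBounded μ g) : EssBounded μ (f + g) := by
  obtain ⟨C, hC⟩ := hf
  obtain ⟨D, hD⟩ := hg
  refine ⟨C + D, ?_⟩
  filter_upwards [hC, hD] with ω h1 h2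
  exact (abs_add_le _ _).trans (add_le_add h1 h2)

theorem const_smul (c : ℝ) (hf : EssBounded μ f) : EssBounded μ (c • f) := by
  obtain ⟨C, hC⟩ := hf
  refine ⟨|c| * C, ?_⟩
  filter_upwards [hC] with ω h1
  simpa [abs_mul] using mul_le_mul_of_nonneg_left h1 (abs_nonneg c)

theorem const (μ : Measure Ω) (c : ℝ) : EssBounded μ (fun _ => c) :=
  ⟨|c|, by simp⟩

theorem one (μ : Measure Ω) : EssBounded μ (1 : Ω → ℝ) := const μ 1

theorem integrable [IsFiniteMeasure μ] (hf : EssBounded μ f) (hm : AEStronglyMeasurable f μ) :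
    Integrable f μ := by
  obtain ⟨C, hC⟩ := hf
  exact Integrable.of_bound hm C hC

theorem condExp (hf : EssBounded μ f) : EssBounded μ (μ[f|m]) := by
  obtain ⟨C, hC⟩ := hf
  exact ⟨C, ae_bdd_abs_condExp_of_ae_bdd_abs hC⟩

end EssBounded

/-! ### Linear liftings -/

/-- `ρ` selects, linearly and positively, representatives of the bounded `m`-measurable
functions. -/
structure IsLinearLifting {Ω : Type*} (m : MeasurableSpace Ω) {m0 : MeasurableSpace Ω}
    (μ : Measure Ω) (ρ : (Ω → ℝ) → Ω → ℝ) : Prop where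
  add : ∀ f g, Measurable[m] f → EssBounded μ f → Measurable[m] g → EssBounded μ g →
    ρ (f + g) = ρ f + ρ g
  smul : ∀ (c : ℝ) f, Measurable[m] f → EssBounded μ f → ρ (c • f) = c • ρ f
  nonneg : ∀ f, Measurable[m] f → EssBounded μ f → 0 ≤ᵐ[μ] f → 0 ≤ ρ f
  one : ρ 1 = 1
  ae_eq : ∀ f, Measurable[m] f → EssBounded μ f → ρ f =ᵐ[μ] f

namespace IsLinearLifting

variable {Ω : Type*} {m m0 : MeasurableSpace Ω} {μ : Measure Ω} {ρ : (Ω → ℝ) → Ω → ℝ}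
  {f g : Ω → ℝ}

theorem mono (h : IsLinearLifting m μ ρ) (hf : Measurable[m] f) (bf : EssBounded μ f)
    (hg : Measurable[m] g) (bg : EssBounded μ g) (hfg : f ≤ᵐ[μ] g) : ρ f ≤ ρ g := by
  have h1 := h.nonneg (g + (-1 : ℝ) • f) (hg.add (hf.const_smul (-1 : ℝ)))
    (bg.add (bf.const_smul _)) (by
      filter_upwards [hfg] with ω hω
      simpa using hω)
  rw [h.add _ _ hg bg (hf.const_smul (-1 : ℝ)) (bf.const_smul _), h.smul _ _ hf bf] at h1
  intro ω
  have := h1 ω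
  simpa using this

theorem congr (h : IsLinearLifting m μ ρ) (hf : Measurable[m] f) (bf : EssBounded μ f)
    (hg : Measurable[m] g) (bg : EssBounded μ g) (hfg : f =ᵐ[μ] g) : ρ f = ρ g :=
  le_antisymm (h.mono hf bf hg bg hfg.le) (h.mono hg bg hf bf hfg.symm.le)

theorem abs_le (h : IsLinearLifting m μ ρ) (hf : Measurable[m] f) {C : ℝ}
    (hC : ∀ᵐ ω ∂μ, |f ω| ≤ C) (ω : Ω) : |ρ f ω| ≤ C := by
  have key : ∀ c : ℝ, ρ (c • (1 : Ω → ℝ)) ω = c := fun c => by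
    rw [h.smul c 1 (@measurable_const _ _ _ m (1 : ℝ)) (EssBounded.one μ), h.one]
    simp
  have mc : ∀ c : ℝ, Measurable[m] (c • (1 : Ω → ℝ)) := fun c =>
    (@measurable_const _ _ _ m (1 : ℝ)).const_smul c
  have bc : ∀ c : ℝ, EssBounded μ (c • (1 : Ω → ℝ)) := fun c => (EssBounded.one μ).const_smul c
  rw [_root_.abs_le]
  constructor
  · have := h.mono (mc (-C)) (bc _) hf ⟨C, hC⟩ (by
      filter_upwards [hC] with ω hω
      simpa using neg_le_of_abs_le hω) ω
    rwa [key] at this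
  · have := h.mono hf ⟨C, hC⟩ (mc C) (bc _) (by
      filter_upwards [hC] with ω hω
      simpa using le_of_abs_le hω) ω
    rwa [key] at this

end IsLinearLifting

/-! ### Partial liftings and upper bounds of chains -/

/-- A linear lifting for the functions that are measurable with respect to some sub-σ-algebra. -/
structure PartialLinearLifting {Ω : Type*} {m0 : MeasurableSpace Ω} (μ : Measure Ω) where
  /-- the sub-σ-algebra -/
  m : MeasurableSpace Ω
  le : m ≤ m0
  /-- the lifting -/
  ρ : (Ω → ℝ) → Ω → ℝ
  isLinearLifting : IsLinearLifting m μ ρ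

namespace PartialLinearLifting

variable {Ω : Type*} {m0 : MeasurableSpace Ω} {μ : Measure Ω}

/-- Only a preorder: the values of `ρ` off the essentially bounded `m`-measurable functions are
irrelevant. -/
instance : Preorder (PartialLinearLifting μ) where
  le a b := a.m ≤ b.m ∧ ∀ f, Measurable[a.m] f → EssBounded μ f → b.ρ f = a.ρ f
  le_refl a := ⟨le_rfl, fun _ _ _ => rfl⟩
  le_trans a b c hab hbc := ⟨hab.1.trans hbc.1, fun f hf bf =>
    (hbc.2 f (hf.mono hab.1 le_rfl) bf).trans (hab.2 f hf bf)⟩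

/-- The constant functions are their own representatives. -/
def trivial (μ : Measure Ω) [NeZero μ] : PartialLinearLifting μ where
  m := ⊥
  le := bot_le
  ρ f := f
  isLinearLifting := by
    refine ⟨fun _ _ _ _ _ _ => rfl, fun _ _ _ _ => rfl, fun f hf _ h ω => ?_, rfl,
      fun _ _ _ => ae_eq_refl _⟩
    -- As `μ ≠ 0`, some point has `f ≥ 0`; a `⊥`-measurable `f` is constant.
    obtain ⟨ω', hω'⟩ := h.exists
    have hset : MeasurableSet[⊥] (f ⁻¹' {f ω}) := hf (measurableSet_singleton _)
    rcases MeasurableSpace.measurableSet_bot_iff.1 hset with h0 | h0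
    · have : ω ∈ f ⁻¹' {f ω} := rfl
      simp [h0] at this
    · have : ω' ∈ f ⁻¹' {f ω} := h0 ▸ mem_univ _
      rw [← (show f ω' = f ω from this)]
      exact hω'

end PartialLinearLifting

open Filter Topology in
theorem Ultrafilter.tendsto_limUnder_of_abs_le {ι : Type*} (U : Ultrafilter ι) {u : ι → ℝ} {C : ℝ}
    (hu : ∀ i, |u i| ≤ C) : Tendsto u U (𝓝 (limUnder U u)) := by
  obtain ⟨x, -, hx⟩ := (isCompact_Icc (a := -C) (b := C)).ultrafilter_le_nhds' (U.map u)
    (Filter.eventually_map.2 (Filter.Eventually.of_forall fun i => abs_le.1 (hu i)))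
  exact tendsto_nhds_limUnder ⟨x, hx⟩

namespace PartialLinearLifting

variable {Ω : Type*} {m0 : MeasurableSpace Ω} {μ : Measure Ω}

/-- The union of a family of σ-algebras in which every countable subfamily is bounded. -/
@[reducible]
def unionMeasurableSpace (c : Set (PartialLinearLifting μ))
    (hc : ∀ s ⊆ c, s.Countable → ∃ b ∈ c, ∀ a ∈ s, a ≤ b) : MeasurableSpace Ω where
  MeasurableSet' s := ∃ a ∈ c, MeasurableSet[a.m] s
  measurableSet_empty := by
    obtain ⟨b, hb, -⟩ := hc ∅ (empty_subset _) countable_empty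
    exact ⟨b, hb, @MeasurableSet.empty _ b.m⟩
  measurableSet_compl := fun s ⟨a, ha, h⟩ => ⟨a, ha, h.compl⟩
  measurableSet_iUnion := fun s h => by
    choose a ha hs using h
    obtain ⟨b, hb, hab⟩ := hc (range a) (range_subset_iff.2 ha) (countable_range a)
    exact ⟨b, hb, MeasurableSet.iUnion fun n => (hab _ (mem_range_self n)).1 _ (hs n)⟩

/-- Measurability of a real function is tested on countably many half-lines with rational endpoint.
-/
theorem exists_measurable_of_measurable_union {c : Set (PartialLinearLifting μ)}
    (hc : ∀ s ⊆ c, s.Countable → ∃ b ∈ c, ∀ a ∈ s, a ≤ b) {f : Ω → ℝ}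
    (hf : Measurable[unionMeasurableSpace c hc] f) : ∃ a ∈ c, Measurable[a.m] f := by
  have h : ∀ q : ℚ, ∃ a ∈ c, MeasurableSet[a.m] (f ⁻¹' Iio (q : ℝ)) := fun q =>
    hf measurableSet_Iio
  choose a ha hs using h
  obtain ⟨b, hb, hab⟩ := hc (range a) (range_subset_iff.2 ha) (countable_range a)
  refine ⟨b, hb, ?_⟩
  let := b.m
  rw [Real.borelSpace.measurable_eq, Real.borel_eq_generateFrom_Iio_rat]
  refine measurable_generateFrom fun t ht => ?_
  simp only [mem_iUnion, mem_singleton_iff] at ht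
  obtain ⟨q, rfl⟩ := ht
  exact (hab _ (mem_range_self q)).1 _ (hs q)

/-- Each axiom involves at most two functions, which live on a common member of `c`; directedness
makes the value of `ρ` independent of the member chosen. -/
theorem exists_ge_of_countably_bounded (c : Set (PartialLinearLifting μ))
    (hc : ∀ s ⊆ c, s.Countable → ∃ b ∈ c, ∀ a ∈ s, a ≤ b) :
    ∃ b : PartialLinearLifting μ, ∀ a ∈ c, a ≤ b := by
  classical
  let ρ : (Ω → ℝ) → Ω → ℝ := fun f =>
    if h : ∃ a ∈ c, Measurable[a.m] f then h.choose.ρ f else 0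
  have ub : ∀ a ∈ c, ∀ a' ∈ c, ∃ b ∈ c, a ≤ b ∧ a' ≤ b := fun a ha a' ha' => by
    obtain ⟨b, hb, h⟩ := hc {a, a'} (by simp [insert_subset_iff, ha, ha']) (by simp)
    exact ⟨b, hb, h a (by simp), h a' (by simp)⟩
  have key : ∀ a ∈ c, ∀ f, Measurable[a.m] f → EssBounded μ f → ρ f = a.ρ f := by
    intro a ha f hf bf
    have h : ∃ a ∈ c, Measurable[a.m] f := ⟨a, ha, hf⟩
    obtain ⟨b, -, h1, h2⟩ := ub a ha _ h.choose_spec.1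
    simp only [ρ, dif_pos h]
    rw [← h1.2 f hf bf, ← h2.2 f h.choose_spec.2 bf]
  refine ⟨⟨unionMeasurableSpace c hc, fun s ⟨a, _, h⟩ => a.le _ h, ρ, ?_⟩, fun a ha =>
    ⟨fun s hs => ⟨a, ha, hs⟩, key a ha⟩⟩
  constructor
  · intro f g hf bf hg bg
    obtain ⟨a, ha, hf⟩ := exists_measurable_of_measurable_union hc hf
    obtain ⟨a', ha', hg⟩ := exists_measurable_of_measurable_union hc hg
    obtain ⟨b, hb, h1, h2⟩ := ub a ha a' ha'
    have hf := hf.mono h1.1 le_rfl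
    have hg := hg.mono h2.1 le_rfl
    rw [key b hb _ (hf.add hg) (bf.add bg), key b hb _ hf bf, key b hb _ hg bg,
      b.isLinearLifting.add _ _ hf bf hg bg]
  · intro r f hf bf
    obtain ⟨a, ha, hf⟩ := exists_measurable_of_measurable_union hc hf
    rw [key a ha _ (hf.const_smul r) (bf.const_smul r), key a ha _ hf bf,
      a.isLinearLifting.smul _ _ hf bf]
  · intro f hf bf h
    obtain ⟨a, ha, hf⟩ := exists_measurable_of_measurable_union hc hf
    rw [key a ha _ hf bf]
    exact a.isLinearLifting.nonneg f hf bf h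
  · obtain ⟨b, hb, -⟩ := hc ∅ (empty_subset _) countable_empty
    rw [key b hb 1 (@measurable_const _ _ _ b.m (1 : ℝ)) (EssBounded.one μ), b.isLinearLifting.one]
  · intro f hf bf
    obtain ⟨a, ha, hf⟩ := exists_measurable_of_measurable_union hc hf
    rw [key a ha _ hf bf]
    exact a.isLinearLifting.ae_eq f hf bf

-- Lift `μ[f|(a n).m]` by `(a n).ρ` and take an ultrafilter limit, which exists at every point by
-- boundedness and keeps linearity and positivity. Lévy's upward theorem identifies it a.e. with
-- `f`; if `f` is already measurable at stage `n`, the sequence is constant from there on.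
open Filter Topology in
theorem exists_ge_of_monotone [IsFiniteMeasure μ] {a : ℕ → PartialLinearLifting μ}
    (ha : Monotone a) : ∃ b : PartialLinearLifting μ, ∀ n, a n ≤ b := by
  let U : Ultrafilter ℕ := hyperfilter ℕ
  have hU : (U : Filter ℕ) ≤ atTop := Nat.hyperfilter_le_atTop
  let ℱ : Filtration ℕ m0 := ⟨fun n => (a n).m, fun i j h => (ha h).1, fun n => (a n).le⟩
  let u : (Ω → ℝ) → Ω → ℕ → ℝ := fun f ω n => (a n).ρ (μ[f|(a n).m]) ω
  let ρ : (Ω → ℝ) → Ω → ℝ := fun f ω => limUnder U (u f ω)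
  have hle : ⨆ n, (a n).m ≤ m0 := iSup_le fun n => (a n).le
  have mE : ∀ (f : Ω → ℝ) n, Measurable[(a n).m] (μ[f|(a n).m]) := fun f n =>
    stronglyMeasurable_condExp.measurable
  have int : ∀ {f : Ω → ℝ}, Measurable[⨆ n, (a n).m] f → EssBounded μ f → Integrable f μ :=
    fun hf bf => bf.integrable (hf.mono hle le_rfl).aestronglyMeasurable
  have tend : ∀ {f : Ω → ℝ}, EssBounded μ f → ∀ ω, Tendsto (u f ω) U (𝓝 (ρ f ω)) := by
    rintro f ⟨C, hC⟩ ω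
    exact U.tendsto_limUnder_of_abs_le fun n =>
      (a n).isLinearLifting.abs_le (mE f n) (ae_bdd_abs_condExp_of_ae_bdd_abs hC) ω
  refine ⟨⟨⨆ n, (a n).m, hle, ρ, ?_⟩, fun n =>
    ⟨le_iSup (fun n => (a n).m) n, fun f hf bf => ?_⟩⟩
  swap
  · ext ω
    refine tendsto_nhds_unique (tend bf ω) (tendsto_const_nhds.congr' ?_)
    filter_upwards [hU (eventually_ge_atTop n)] with k hk
    have hfk : Measurable[(a k).m] f := hf.mono (ha hk).1 le_rfl
    simp only [u]
    rw [condExp_of_stronglyMeasurable (a k).le hfk.stronglyMeasurable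
      (bf.integrable (hfk.mono (a k).le le_rfl).aestronglyMeasurable), (ha hk).2 f hf bf]
  constructor
  · intro f g hf bf hg bg
    ext ω
    refine tendsto_nhds_unique (tend (bf.add bg) ω) (((tend bf ω).add (tend bg ω)).congr fun n => ?_)
    simp only [u]
    rw [(a n).isLinearLifting.congr (mE (f + g) n) (bf.add bg).condExp ((mE f n).add (mE g n))
      (bf.condExp.add bg.condExp) (condExp_add (int hf bf) (int hg bg) _),
      (a n).isLinearLifting.add _ _ (mE f n) bf.condExp (mE g n) bg.condExp]
    rfl
  · intro r f hf bf
    ext ω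
    refine tendsto_nhds_unique (tend (bf.const_smul r) ω) (((tend bf ω).const_smul r).congr
      fun n => ?_)
    simp only [u]
    rw [(a n).isLinearLifting.congr (mE (r • f) n) (bf.const_smul r).condExp
      ((mE f n).const_smul r) (bf.condExp.const_smul r) (condExp_smul r f _),
      (a n).isLinearLifting.smul _ _ (mE f n) bf.condExp]
    rfl
  · intro f hf bf h ω
    exact ge_of_tendsto (tend bf ω) (Eventually.of_forall fun n =>
      (a n).isLinearLifting.nonneg _ (mE f n) bf.condExp (condExp_nonneg h) ω)
  · ext ω
    refine tendsto_nhds_unique (tend (EssBounded.one μ) ω) (tendsto_const_nhds.congr fun n => ?_)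
    have h1 : μ[(1 : Ω → ℝ)|(a n).m] = 1 := condExp_const (a n).le (1 : ℝ)
    simp only [u]
    rw [h1, (a n).isLinearLifting.one]
  · intro f hf bf
    have h1 : ∀ᵐ ω ∂μ, ∀ n, u f ω n = (μ[f|(a n).m]) ω := ae_all_iff.2 fun n =>
      (a n).isLinearLifting.ae_eq _ (mE f n) bf.condExp
    filter_upwards [h1, (int hf bf).tendsto_ae_condExp (ℱ := ℱ) hf.stronglyMeasurable]
      with ω hω hlim
    refine tendsto_nhds_unique (tend bf ω) ((hlim.mono_left hU).congr fun n => (hω n).symm)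

/-- A countable subset with no upper bound in the chain is cofinal in it, by totality. -/
theorem bddAbove_of_isChain [IsFiniteMeasure μ] [NeZero μ] {c : Set (PartialLinearLifting μ)}
    (hc : IsChain (· ≤ ·) c) : BddAbove c := by
  by_cases h : ∀ s ⊆ c, s.Countable → ∃ b ∈ c, ∀ a ∈ s, a ≤ b
  · exact exists_ge_of_countably_bounded c h
  push Not at h
  obtain ⟨s, hs, hsc, hub⟩ := h
  rcases s.eq_empty_or_nonempty with rfl | hne
  -- Here `hub` forces `c` to be empty.
  · exact ⟨trivial μ, fun a ha => by simpa using hub a ha⟩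
  obtain ⟨x, rfl⟩ := hsc.exists_eq_range hne
  have hdir : Directed (· ≤ ·) x := fun i j => by
    rcases hc.total (hs (mem_range_self i)) (hs (mem_range_self j)) with h | h
    · exact ⟨j, h, le_rfl⟩
    · exact ⟨i, le_rfl, h⟩
  obtain ⟨b, hb⟩ := exists_ge_of_monotone hdir.sequence_mono
  refine ⟨b, fun a ha => ?_⟩
  obtain ⟨y, ⟨i, rfl⟩, hi⟩ := hub a ha
  have h1 : a ≤ x i := ((hc.total ha (hs (mem_range_self i))).resolve_right hi)
  exact (h1.trans (hdir.le_sequence i)).trans (hb _)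

end PartialLinearLifting

/-! ### Conditional expectation relative to a set -/

section CondExpOn

variable {Ω : Type*} {m m0 : MeasurableSpace Ω} {μ : Measure Ω} {A : Set Ω} {f g : Ω → ℝ}

/-- The conditional expectation of `f` under the probability conditioned on `A`, continued by the
ordinary conditional expectation where `A` has conditional probability zero. -/
noncomputable def condExpOn (m : MeasurableSpace Ω) {m0 : MeasurableSpace Ω} (μ : Measure Ω)
    (A : Set Ω) (f : Ω → ℝ) : Ω → ℝ := fun ω =>
  open Classical in
  if (μ[A.indicator (1 : Ω → ℝ)|m]) ω = 0 then (μ[f|m]) ω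
  else (μ[A.indicator f|m]) ω / (μ[A.indicator (1 : Ω → ℝ)|m]) ω

theorem measurable_condExpOn : Measurable[m] (condExpOn m μ A f) := by
  have h : ∀ f : Ω → ℝ, Measurable[m] (μ[f|m]) := fun f => stronglyMeasurable_condExp.measurable
  exact Measurable.ite (h _ (measurableSet_singleton 0)) (h _) ((h _).div (h _))

theorem EssBounded.indicator (hf : EssBounded μ f) (A : Set Ω) : EssBounded μ (A.indicator f) := by
  obtain ⟨C, hC⟩ := hf
  refine ⟨C, ?_⟩
  filter_upwards [hC] with ω h
  by_cases hω : ω ∈ A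
  · simpa [hω] using h
  · simpa [hω] using (abs_nonneg _).trans h

theorem condExp_indicator_one_nonneg : 0 ≤ᵐ[μ] μ[A.indicator (1 : Ω → ℝ)|m] :=
  condExp_nonneg (Filter.Eventually.of_forall fun _ => indicator_nonneg (fun _ _ => zero_le_one) _)

theorem condExpOn_add [IsFiniteMeasure μ] (hA : MeasurableSet A) (hf : Measurable f)
    (bf : EssBounded μ f) (hg : Measurable g) (bg : EssBounded μ g) :
    condExpOn m μ A (f + g) =ᵐ[μ] condExpOn m μ A f + condExpOn m μ A g := by
  have If := bf.integrable hf.aestronglyMeasurable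
  have Ig := bg.integrable hg.aestronglyMeasurable
  filter_upwards [condExp_add If Ig m, condExp_add (If.indicator hA) (Ig.indicator hA) m]
    with ω h1 h2
  rw [← indicator_add'] at h2
  simp only [condExpOn, Pi.add_apply, h1, h2]
  split_ifs
  · rfl
  · rw [add_div]

theorem condExpOn_smul (r : ℝ) :
    condExpOn m μ A (r • f) =ᵐ[μ] r • condExpOn m μ A f := by
  filter_upwards [condExp_smul r f m, condExp_smul r (A.indicator f) m] with ω h1 h2
  rw [show r • A.indicator f = A.indicator (r • f) from (indicator_const_smul A r f).symm] at h2
  simp only [condExpOn, Pi.smul_apply, h1, h2]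
  split_ifs
  · rfl
  · simp [mul_div_assoc]

theorem condExpOn_nonneg (h : 0 ≤ᵐ[μ] f) : 0 ≤ᵐ[μ] condExpOn m μ A f := by
  have hA : 0 ≤ᵐ[μ] A.indicator f := by
    filter_upwards [h] with ω hω
    exact indicator_apply_nonneg fun _ => hω
  filter_upwards [condExp_nonneg (m := m) h, condExp_nonneg (m := m) hA,
    condExp_indicator_one_nonneg (m := m) (A := A) (μ := μ)] with ω h1 h2 h3
  simp only [condExpOn]
  split_ifs
  · exact h1
  · exact div_nonneg h2 h3

theorem condExp_indicator_eq_mul [IsFiniteMeasure μ] (hA : MeasurableSet A) (hf : Measurable f)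
    (bf : EssBounded μ f) (hg : Measurable[m] g) (hfg : EqOn f g A) :
    μ[A.indicator f|m] =ᵐ[μ] g * μ[A.indicator (1 : Ω → ℝ)|m] := by
  have h : A.indicator f = g * A.indicator (1 : Ω → ℝ) := by
    ext ω
    by_cases hω : ω ∈ A
    · simp [hω, hfg hω]
    · simp [hω]
  rw [h]
  refine condExp_mul_of_stronglyMeasurable_left hg.stronglyMeasurable ?_ ?_
  · rw [← h]
    exact (bf.integrable hf.aestronglyMeasurable).indicator hA
  · exact (integrable_const (1 : ℝ)).indicator hA

/-- The factor `f` pulls out and the quotient cancels; where the denominator vanishes, the fallback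
`μ[f|m]` is again `f`. -/
theorem condExpOn_of_measurable [IsFiniteMeasure μ] (hm : m ≤ m0) (hA : MeasurableSet A)
    (hf : Measurable[m] f) (bf : EssBounded μ f) : condExpOn m μ A f =ᵐ[μ] f := by
  have hf0 : Measurable f := hf.mono hm le_rfl
  filter_upwards [condExp_indicator_eq_mul hA hf0 bf hf (fun _ _ => rfl)] with ω h
  simp only [condExpOn, h]
  rw [condExp_of_stronglyMeasurable hm hf.stronglyMeasurable
    (bf.integrable hf0.aestronglyMeasurable)]
  split_ifs with h0
  · rfl
  · exact mul_div_cancel_right₀ _ h0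

/-- Positivity and reproduction of constants preserve an upper bound `C`; apply this to `f` and
`-f`. -/
theorem essBounded_condExpOn [IsFiniteMeasure μ] (hm : m ≤ m0) (hA : MeasurableSet A)
    (hf : Measurable f) (bf : EssBounded μ f) : EssBounded μ (condExpOn m μ A f) := by
  obtain ⟨C, hC⟩ := id bf
  have key : ∀ g : Ω → ℝ, Measurable g → EssBounded μ g → (∀ᵐ ω ∂μ, g ω ≤ C) →
      ∀ᵐ ω ∂μ, condExpOn m μ A g ω ≤ C := by
    intro g hg bg hgC
    have h0 : 0 ≤ᵐ[μ] (fun _ => C) + (-1 : ℝ) • g := by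
      filter_upwards [hgC] with ω h
      simpa using h
    filter_upwards [condExpOn_nonneg (m := m) (A := A) h0,
      condExpOn_add (m := m) hA measurable_const (EssBounded.const μ C) (hg.const_smul (-1 : ℝ))
        (bg.const_smul (-1 : ℝ)), condExpOn_smul (m := m) (A := A) (μ := μ) (f := g) (-1),
      condExpOn_of_measurable hm hA measurable_const (EssBounded.const μ C)] with ω h1 h2 h3 h4
    rw [h2, Pi.add_apply, h3, h4] at h1
    simpa using h1
  refine ⟨C, ?_⟩
  filter_upwards [key f hf bf (hC.mono fun ω h => le_of_abs_le h),
    key ((-1 : ℝ) • f) (hf.const_smul (-1 : ℝ)) (bf.const_smul _)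
      (hC.mono fun ω h => by simpa using neg_le.1 (neg_le_of_abs_le h)),
    condExpOn_smul (m := m) (A := A) (μ := μ) (f := f) (-1)] with ω h1 h2 h3
  rw [h3] at h2
  refine abs_le.2 ⟨?_, h1⟩
  simp at h2
  linarith

/-- Integrating over the zero set `Z` of the conditional expectation gives `μ (A ∩ Z) = 0`. -/
theorem condExp_indicator_one_ne_zero [IsFiniteMeasure μ] (hm : m ≤ m0) (hA : MeasurableSet A) :
    ∀ᵐ ω ∂μ, ω ∈ A → (μ[A.indicator (1 : Ω → ℝ)|m]) ω ≠ 0 := by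
  set Z : Set Ω := {ω | (μ[A.indicator (1 : Ω → ℝ)|m]) ω = 0} with hZ
  have mZ : MeasurableSet[m] Z :=
    (stronglyMeasurable_condExp.measurable : Measurable[m] _) (measurableSet_singleton 0)
  have h1 : ∫ ω in Z, A.indicator (1 : Ω → ℝ) ω ∂μ = 0 := by
    rw [← setIntegral_condExp (f := A.indicator (1 : Ω → ℝ)) hm
      ((integrable_const (1 : ℝ)).indicator hA) mZ]
    exact setIntegral_eq_zero_of_forall_eq_zero fun ω hω => hω
  rw [integral_indicator_one hA, measureReal_eq_zero_iff, Measure.restrict_apply hA] at h1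
  refine (measure_eq_zero_iff_ae_notMem.1 h1).mono fun ω h hA h0 => h ⟨hA, h0⟩

theorem condExpOn_eq_of_eqOn [IsFiniteMeasure μ] (hm : m ≤ m0) (hA : MeasurableSet A)
    (hf : Measurable f) (bf : EssBounded μ f) (hg : Measurable[m] g) (hfg : EqOn f g A) :
    ∀ᵐ ω ∂μ, ω ∈ A → condExpOn m μ A f ω = f ω := by
  filter_upwards [condExp_indicator_eq_mul hA hf bf hg hfg, condExp_indicator_one_ne_zero hm hA]
    with ω h1 h2 hω
  simp only [condExpOn, if_neg (h2 hω), h1]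
  rw [hfg hω]
  exact mul_div_cancel_right₀ _ (h2 hω)

end CondExpOn

/-! ### Adjoining a set to a partial lifting -/

/-- The enlarged σ-algebra is pulled back along `ω ↦ (ω, ω ∈ A)`, so `f` factors through this map
(Doob–Dynkin). -/
theorem exists_measurable_eqOn_of_measurable_sup {Ω : Type*} {m : MeasurableSpace Ω} {A : Set Ω}
    {f : Ω → ℝ} (hf : Measurable[m ⊔ MeasurableSpace.comap (· ∈ A) ⊤] f) :
    ∃ g h : Ω → ℝ, Measurable[m] g ∧ Measurable[m] h ∧ EqOn f g A ∧ EqOn f h Aᶜ := by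
  have hcomap : m ⊔ MeasurableSpace.comap (· ∈ A) ⊤ =
      MeasurableSpace.comap (fun ω => (ω, ω ∈ A)) (m.prod ⊤) := by
    rw [MeasurableSpace.prod, MeasurableSpace.comap_sup, MeasurableSpace.comap_comp,
      MeasurableSpace.comap_comp]
    change _ = MeasurableSpace.comap id m ⊔ _
    rw [MeasurableSpace.comap_id]
    rfl
  rw [hcomap] at hf
  obtain ⟨k, hk, rfl⟩ := hf.exists_eq_measurable_comp
  refine ⟨fun ω => k (ω, True), fun ω => k (ω, False), hk.comp measurable_prodMk_right,
    hk.comp measurable_prodMk_right, fun ω hω => ?_, fun ω hω => ?_⟩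
  · simp [hω]
  · have : ω ∉ A := hω
    simp [this]

namespace PartialLinearLifting

variable {Ω : Type*} {m0 : MeasurableSpace Ω} {μ : Measure Ω}

/-- On `A` lift the conditional expectation relative to `A`, on `Aᶜ` that relative to `Aᶜ`. Both
reproduce the functions already lifted, and each recovers on its own set any function of the
enlarged σ-algebra. -/
theorem exists_ge_measurableSet [IsFiniteMeasure μ] (a : PartialLinearLifting μ) {A : Set Ω}
    (hA : MeasurableSet A) : ∃ b : PartialLinearLifting μ, a ≤ b ∧ MeasurableSet[b.m] A := by
  classical
  have hm' : a.m ⊔ MeasurableSpace.comap (· ∈ A) ⊤ ≤ m0 := by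
    refine sup_le a.le ?_
    rintro _ ⟨s, -, rfl⟩
    exact hA.mem s.toFinite.measurableSet
  let ρ : (Ω → ℝ) → Ω → ℝ := fun f =>
    A.piecewise (a.ρ (condExpOn a.m μ A f)) (a.ρ (condExpOn a.m μ Aᶜ f))
  have hρ : ∀ f : Ω → ℝ, ρ f =
    A.piecewise (a.ρ (condExpOn a.m μ A f)) (a.ρ (condExpOn a.m μ Aᶜ f)) := fun _ => rfl
  have L := a.isLinearLifting
  have mC : ∀ (B : Set Ω) (f : Ω → ℝ), Measurable[a.m] (condExpOn a.m μ B f) := fun _ _ =>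
    measurable_condExpOn
  have ext : ∀ f, Measurable[a.m] f → EssBounded μ f → ρ f = a.ρ f := fun f hf bf => by
    have hf0 : Measurable f := hf.mono a.le le_rfl
    rw [hρ, L.congr (mC _ _) (essBounded_condExpOn a.le hA hf0 bf) hf bf
      (condExpOn_of_measurable a.le hA hf bf), L.congr (mC _ _)
      (essBounded_condExpOn a.le hA.compl hf0 bf) hf bf
      (condExpOn_of_measurable a.le hA.compl hf bf), piecewise_same]
  refine ⟨⟨_, hm', ρ, ?_⟩, ⟨le_sup_left, ext⟩, ?_⟩
  swap
  · exact (le_sup_right : _ ≤ a.m ⊔ MeasurableSpace.comap (· ∈ A) ⊤) _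
      ⟨{True}, MeasurableSpace.measurableSet_top, by ext; simp⟩
  constructor
  · intro f g hf bf hg bg
    have hf := hf.mono hm' le_rfl
    have hg := hg.mono hm' le_rfl
    have key : ∀ B : Set Ω, MeasurableSet B → a.ρ (condExpOn a.m μ B (f + g)) =
        a.ρ (condExpOn a.m μ B f) + a.ρ (condExpOn a.m μ B g) := fun B hB => by
      have b1 := essBounded_condExpOn a.le hB hf bf
      have b2 := essBounded_condExpOn a.le hB hg bg
      rw [L.congr (mC _ _) (essBounded_condExpOn a.le hB (hf.add hg) (bf.add bg))
        ((mC B f).add (mC B g)) (b1.add b2) (condExpOn_add hB hf bf hg bg),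
        L.add _ _ (mC _ _) b1 (mC _ _) b2]
    rw [hρ, hρ, hρ, key A hA, key _ hA.compl, ← piecewise_add]
  · intro r f hf bf
    have hf := hf.mono hm' le_rfl
    have key : ∀ B : Set Ω, MeasurableSet B → a.ρ (condExpOn a.m μ B (r • f)) =
        r • a.ρ (condExpOn a.m μ B f) := fun B hB => by
      have b1 := essBounded_condExpOn a.le hB hf bf
      rw [L.congr (mC _ _) (essBounded_condExpOn a.le hB (hf.const_smul r) (bf.const_smul r))
        ((mC B f).const_smul r) (b1.const_smul r) (condExpOn_smul r), L.smul _ _ (mC _ _) b1]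
    rw [hρ, hρ, key A hA, key _ hA.compl, ← piecewise_smul]
  · intro f hf bf h ω
    have hf := hf.mono hm' le_rfl
    have key : ∀ B : Set Ω, MeasurableSet B → 0 ≤ a.ρ (condExpOn a.m μ B f) := fun B hB =>
      L.nonneg _ (mC _ _) (essBounded_condExpOn a.le hB hf bf) (condExpOn_nonneg h)
    by_cases hω : ω ∈ A
    · simpa [hρ, hω] using key A hA ω
    · simpa [hρ, hω] using key _ hA.compl ω
  · rw [ext 1 (@measurable_const _ _ _ a.m (1 : ℝ)) (EssBounded.one μ), L.one]
  · intro f hf bf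
    obtain ⟨g, h, hg, hh, hfg, hfh⟩ := exists_measurable_eqOn_of_measurable_sup hf
    have hf := hf.mono hm' le_rfl
    filter_upwards [condExpOn_eq_of_eqOn a.le hA hf bf hg hfg,
      condExpOn_eq_of_eqOn a.le hA.compl hf bf hh hfh,
      L.ae_eq _ (mC A f) (essBounded_condExpOn a.le hA hf bf),
      L.ae_eq _ (mC Aᶜ f) (essBounded_condExpOn a.le hA.compl hf bf)] with ω h1 h2 h3 h4
    by_cases hω : ω ∈ A
    · simp [hρ, hω, h3, h1 hω]
    · simp [hρ, hω, h4, h2 hω]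

end PartialLinearLifting

/-! ### Existence of linear liftings -/

/-- Every nonzero finite measure has a linear lifting. -/
theorem exists_isLinearLifting {Ω : Type*} {m0 : MeasurableSpace Ω} (μ : Measure Ω)
    [IsFiniteMeasure μ] [NeZero μ] : ∃ ρ, IsLinearLifting m0 μ ρ := by
  obtain ⟨a, ha⟩ := zorn_le fun _ => PartialLinearLifting.bddAbove_of_isChain (μ := μ)
  have h : m0 ≤ a.m := fun A hA => by
    obtain ⟨b, hab, hb⟩ := a.exists_ge_measurableSet hA
    exact (ha hab).1 _ hb
  have h0 := a.isLinearLifting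
  rw [le_antisymm a.le h] at h0
  exact ⟨a.ρ, h0⟩

/-- By completeness null traces are measurable, so `s` need not be assumed measurable. -/
theorem IsStrictlyLocalizable.exists_pieces {Ω : Type*} [MeasurableSpace Ω] {μ : Measure Ω}
    [μ.IsComplete] (hμ : IsStrictlyLocalizable μ) :
    ∃ 𝒜 : Set (Set Ω), (∀ A ∈ 𝒜, MeasurableSet A ∧ μ A < ∞) ∧ 𝒜.PairwiseDisjoint id ∧
      ∀ s : Set Ω, (∀ A ∈ 𝒜, μ (s ∩ A) = 0) → μ s = 0 := by
  obtain ⟨𝒜, h1, h2, -, h4, h5⟩ := hμ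
  refine ⟨𝒜, h1, h2, fun s hs => ?_⟩
  rw [h5 s (h4 s fun A hA => measurableSet_of_null (hs A hA)), ENNReal.tsum_eq_zero]
  exact fun A => hs A A.2

/-- Every nonzero complete strictly localizable measure has a linear lifting. -/
theorem IsStrictlyLocalizable.exists_isLinearLifting {Ω : Type*} [m0 : MeasurableSpace Ω]
    {μ : Measure Ω} [μ.IsComplete] (hμ : IsStrictlyLocalizable μ) (h0 : μ ≠ 0) :
    ∃ ρ, IsLinearLifting m0 μ ρ := by
  classical
  obtain ⟨𝒜, hA, hdisj, hnull⟩ := hμ.exists_pieces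
  have hR : ∀ A : Set Ω, ∃ ρ, A ∈ 𝒜 → μ A ≠ 0 → IsLinearLifting m0 (μ.restrict A) ρ := by
    intro A
    by_cases h : A ∈ 𝒜 ∧ μ A ≠ 0
    · have : IsFiniteMeasure (μ.restrict A) := isFiniteMeasure_restrict.2 (hA A h.1).2.ne
      have : NeZero (μ.restrict A) := ⟨by simpa using h.2⟩
      obtain ⟨ρ, hρ⟩ := _root_.exists_isLinearLifting (μ.restrict A)
      exact ⟨ρ, fun _ _ => hρ⟩
    · exact ⟨0, fun h1 h2 => absurd ⟨h1, h2⟩ h⟩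
  choose R hR using hR
  obtain ⟨A₀, hA₀, hμA₀⟩ : ∃ A ∈ 𝒜, μ A ≠ 0 := by
    by_contra! h
    refine h0 (Measure.measure_univ_eq_zero.1 (hnull univ fun A hA => ?_))
    simpa using h A hA
  -- The axioms must hold at every point, so points in no piece of positive measure borrow the
  -- lifting of `A₀`; together they form a null set.
  have hπ : ∀ ω, ∃ A ∈ 𝒜, μ A ≠ 0 ∧ ∀ B ∈ 𝒜, μ B ≠ 0 → ω ∈ B → A = B := by
    intro ω
    by_cases h : ∃ A ∈ 𝒜, μ A ≠ 0 ∧ ω ∈ A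
    · obtain ⟨A, hA, hμA, hω⟩ := h
      exact ⟨A, hA, hμA, fun B hB _ hωB => hdisj.elim_set hA hB ω hω hωB⟩
    · exact ⟨A₀, hA₀, hμA₀, fun B hB hμB hω => absurd ⟨B, hB, hμB, hω⟩ h⟩
  choose π hπ𝒜 hπμ hπ using hπ
  have L : ∀ ω, IsLinearLifting m0 (μ.restrict (π ω)) (R (π ω)) := fun ω =>
    hR _ (hπ𝒜 ω) (hπμ ω)
  have res : ∀ {f : Ω → ℝ} (A : Set Ω), EssBounded μ f → EssBounded (μ.restrict A) f :=
    fun A ⟨C, hC⟩ => ⟨C, ae_restrict_of_ae hC⟩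
  refine ⟨fun f ω => R (π ω) f ω, ?_, ?_, ?_, ?_, ?_⟩
  · intro f g hf bf hg bg
    ext ω
    exact congrFun ((L ω).add f g hf (res _ bf) hg (res _ bg)) ω
  · intro c f hf bf
    ext ω
    exact congrFun ((L ω).smul c f hf (res _ bf)) ω
  · intro f hf bf h ω
    exact (L ω).nonneg f hf (res _ bf) (ae_restrict_of_ae h) ω
  · ext ω
    exact congrFun (L ω).one ω
  · intro f hf bf
    refine measure_mono_null (t := {ω | R (π ω) f ω ≠ f ω}) (fun _ h => h) (hnull _ fun A hA' => ?_)
    by_cases hμA : μ A = 0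
    · exact measure_mono_null inter_subset_right hμA
    · have h1 := (ae_restrict_iff' (hA A hA').1).1 ((hR A hA' hμA).ae_eq f hf (res A bf))
      refine measure_mono_null ?_ h1
      rintro ω ⟨h2, hωA⟩ h3
      have h2 : R (π ω) f ω ≠ f ω := h2
      rw [hπ ω A hA' hμA hωA] at h2
      exact h2 (h3 hωA)

/-! ### The σ*-seminorm and lifted multipliers -/

section SigmaStarLemmas

variable {Ω X : Type*} [MeasurableSpace Ω] [NormedAddCommGroup X] [NormedSpace ℝ X]
  {P : Submodule ℝ (StrongDual ℝ X)} {μ : Measure Ω} {f g : Ω → X}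

theorem ae_abs_le_sigmaStarNorm (hf : sigmaStarNorm P μ f < ∞) {u : StrongDual ℝ X} (hu : u ∈ P) :
    ∀ᵐ ω ∂μ, |u (f ω)| ≤ (sigmaStarNorm P μ f).toReal * ‖u‖ := by
  rcases eq_or_ne u 0 with rfl | h0
  · simp
  have hn : 0 < ‖u‖ := norm_pos_iff.2 h0
  have hmem : ‖u‖⁻¹ • u ∈ P ∧ ‖‖u‖⁻¹ • u‖ ≤ 1 :=
    ⟨P.smul_mem _ hu, by rw [norm_smul, norm_inv, norm_norm, inv_mul_cancel₀ hn.ne']⟩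
  have hle : essSup (fun ω => ‖(‖u‖⁻¹ • u) (f ω)‖ₑ) μ ≤ sigmaStarNorm P μ f :=
    le_iSup (fun u : {u : StrongDual ℝ X // u ∈ P ∧ ‖u‖ ≤ 1} =>
      essSup (fun ω => ‖u.1 (f ω)‖ₑ) μ) ⟨_, hmem⟩
  filter_upwards [ENNReal.ae_le_essSup (μ := μ) fun ω => ‖(‖u‖⁻¹ • u) (f ω)‖ₑ] with ω hω
  have h1 := ENNReal.toReal_mono hf.ne (hω.trans hle)
  rw [toReal_enorm, show (‖u‖⁻¹ • u) (f ω) = ‖u‖⁻¹ • u (f ω) from rfl, norm_smul, norm_inv,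
    norm_norm, inv_mul_le_iff₀ hn] at h1
  rwa [mul_comm, ← Real.norm_eq_abs]

theorem sigmaStarEquiv_iff :
    SigmaStarEquiv P μ f g ↔ ∀ u ∈ P, (fun ω => u (f ω)) =ᵐ[μ] fun ω => u (g ω) := by
  refine ⟨fun h u hu => ?_, fun h => ?_⟩
  · have h' : sigmaStarNorm P μ (fun ω => f ω - g ω) = 0 := h
    filter_upwards [ae_abs_le_sigmaStarNorm (h'.trans_lt ENNReal.zero_lt_top) hu] with ω hω
    rw [h', ENNReal.toReal_zero, zero_mul, abs_nonpos_iff, map_sub] at hω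
    exact sub_eq_zero.1 hω
  · refine le_antisymm (iSup_le fun u => essSup_le_of_ae_le 0 ?_) bot_le
    filter_upwards [h u.1 u.2.1] with ω hω
    simp [hω]

theorem MemSigmaStar.congr [μ.IsComplete] (hf : MemSigmaStar P μ f)
    (h : ∀ u ∈ P, (fun ω => u (g ω)) =ᵐ[μ] fun ω => u (f ω)) : MemSigmaStar P μ g := by
  refine ⟨fun u hu => (hf.measurable u hu).congr_ae (h u hu).symm, ?_⟩
  refine lt_of_eq_of_lt (iSup_congr fun u => essSup_congr_ae ?_) hf.bounded
  filter_upwards [h u.1 u.2.1] with ω hω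
  rw [hω]

end SigmaStarLemmas

section MultiplierLemmas

variable {F : Type*} [NormedAddCommGroup F] [NormedSpace ℝ F] {Ω : Type*}
  {m0 : MeasurableSpace Ω} {μ : Measure Ω} {M N : Ω → StrongDual ℝ F →L[ℝ] StrongDual ℝ F}

theorem simpleTensor_mem_projTensor (φ : StrongDual ℝ F) (v : F) :
    simpleTensor φ v ∈ projTensor F :=
  Submodule.le_topologicalClosure _ (Submodule.subset_span ⟨φ, v, rfl⟩)

theorem norm_simpleTensor_le (φ : StrongDual ℝ F) (v : F) : ‖simpleTensor φ v‖ ≤ ‖φ‖ * ‖v‖ := by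
  refine ContinuousLinearMap.opNorm_le_bound _ (by positivity) fun S => ?_
  rw [simpleTensor_apply]
  calc ‖S φ v‖ ≤ ‖S φ‖ * ‖v‖ := (S φ).le_opNorm v
    _ ≤ ‖S‖ * ‖φ‖ * ‖v‖ := by gcongr; exact S.le_opNorm φ
    _ = ‖φ‖ * ‖v‖ * ‖S‖ := by ring

-- A sequence from the span converging to `u` costs only countably many null sets.
open Filter Topology in
theorem ae_eq_of_mem_projTensor (h : ∀ φ v, (fun ω => N ω φ v) =ᵐ[μ] fun ω => M ω φ v) :
    ∀ u ∈ projTensor F, (fun ω => u (N ω)) =ᵐ[μ] fun ω => u (M ω) := by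
  have hspan : ∀ u ∈ Submodule.span ℝ
      {u | ∃ (v' : StrongDual ℝ F) (v : F), u = simpleTensor v' v},
      (fun ω => u (N ω)) =ᵐ[μ] fun ω => u (M ω) := by
    intro u hu
    induction hu using Submodule.span_induction with
    | mem u hu =>
      obtain ⟨φ, v, rfl⟩ := hu
      exact h φ v
    | zero => exact ae_eq_refl _
    | add u w _ _ h1 h2 => exact h1.add h2
    | smul c u _ h1 => exact h1.const_smul c
  intro u hu
  obtain ⟨w, hw, hlim⟩ := mem_closure_iff_seq_limit.1 hu
  filter_upwards [ae_all_iff.2 fun n => hspan (w n) (hw n)] with ω hω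
  have ev : ∀ S, Tendsto (fun n => w n S) atTop (𝓝 (u S)) := fun S =>
    ((ContinuousLinearMap.apply ℝ ℝ S).continuous.tendsto u).comp hlim
  exact tendsto_nhds_unique (ev (N ω)) ((ev (M ω)).congr fun n => (hω n).symm)

theorem exists_bound_of_memSigmaStar (hM : MemSigmaStar (projTensor F) μ M) :
    ∃ K : ℝ, ∀ φ v, ∀ᵐ ω ∂μ, |M ω φ v| ≤ K * ‖φ‖ * ‖v‖ := by
  refine ⟨(sigmaStarNorm (projTensor F) μ M).toReal, fun φ v => ?_⟩
  filter_upwards [ae_abs_le_sigmaStarNorm hM.bounded (simpleTensor_mem_projTensor φ v)] with ω hω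
  rw [simpleTensor_apply] at hω
  refine hω.trans ?_
  rw [mul_assoc]
  exact mul_le_mul_of_nonneg_left (norm_simpleTensor_le φ v) ENNReal.toReal_nonneg

/-- The a.e. bound on `M ω φ v` becomes a bound at every `ω` after lifting, so the bilinear form
defines an operator. -/
theorem exists_lift_of_isLinearLifting {ρ : (Ω → ℝ) → Ω → ℝ} (hρ : IsLinearLifting m0 μ ρ)
    (hM : MemSigmaStar (projTensor F) μ M) :
    ∃ N : Ω → StrongDual ℝ F →L[ℝ] StrongDual ℝ F,
      ∀ ω φ v, N ω φ v = ρ (fun ω' => M ω' φ v) ω := by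
  obtain ⟨K, hK⟩ := exists_bound_of_memSigmaStar hM
  have mM : ∀ φ v, Measurable fun ω => M ω φ v := fun φ v =>
    hM.measurable _ (simpleTensor_mem_projTensor φ v)
  have bM : ∀ φ v, EssBounded μ fun ω => M ω φ v := fun φ v => ⟨_, hK φ v⟩
  refine ⟨fun ω => LinearMap.mkContinuous₂ (LinearMap.mk₂ ℝ
    (fun (φ : StrongDual ℝ F) (v : F) => ρ (fun ω' => M ω' φ v) ω) ?_ ?_ ?_ ?_) K ?_,
    fun _ _ _ => rfl⟩
  · intro φ ψ v
    rw [← Pi.add_apply, ← hρ.add _ _ (mM φ v) (bM φ v) (mM ψ v) (bM ψ v)]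
    congr 2
    ext ω'
    simp
  · intro c φ v
    rw [← Pi.smul_apply, ← hρ.smul c _ (mM φ v) (bM φ v)]
    congr 2
    ext ω'
    simp
  · intro φ v w
    rw [← Pi.add_apply, ← hρ.add _ _ (mM φ v) (bM φ v) (mM φ w) (bM φ w)]
    congr 2
    ext ω'
    simp
  · intro c φ v
    rw [← Pi.smul_apply, ← hρ.smul c _ (mM φ v) (bM φ v)]
    congr 2
    ext ω'
    simp
  · intro φ v
    exact hρ.abs_le (mM φ v) (hK φ v) ω

end MultiplierLemmas

/-! ### Uniform null sets from separable ranges -/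

theorem MeasureTheory.AEStronglyMeasurable.ae_clm_apply_eq {Ω E G : Type*} [MeasurableSpace Ω]
    {μ : Measure Ω} [NormedAddCommGroup E] [NormedSpace ℝ E] [NormedAddCommGroup G]
    [NormedSpace ℝ G] {f : Ω → E} (hf : AEStronglyMeasurable f μ) {S S' : Ω → E →L[ℝ] G}
    (h : ∀ e, ∀ᵐ ω ∂μ, S ω e = S' ω e) : ∀ᵐ ω ∂μ, S ω (f ω) = S' ω (f ω) := by
  obtain ⟨g, hg, hfg⟩ := hf
  obtain ⟨c, hc, hcl⟩ := hg.isSeparable_range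
  filter_upwards [hfg, (ae_ball_iff hc).2 fun e _ => h e] with ω hω hS
  rw [hω]
  exact (EqOn.closure hS (S ω).continuous (S' ω).continuous) (hcl (mem_range_self ω))

/-- `F` need not be separable: the sets `{φ | φ v < 0}` are open in the separable range, and by
Lindelöf countably many have the same union. -/
theorem MeasureTheory.AEStronglyMeasurable.ae_isPositiveFunctional {Ω F : Type*}
    [MeasurableSpace Ω] {μ : Measure Ω} [NormedAddCommGroup F] [NormedSpace ℝ F] [Lattice F]
    {f : Ω → StrongDual ℝ F} (hf : AEStronglyMeasurable f μ)
    (h : ∀ v : F, 0 ≤ v → ∀ᵐ ω ∂μ, 0 ≤ f ω v) : ∀ᵐ ω ∂μ, IsPositiveFunctional (f ω) := by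
  obtain ⟨g, hg, hfg⟩ := hf
  have : SecondCountableTopology (range g) := hg.isSeparable_range.secondCountableTopology
  obtain ⟨T, hT, hcover⟩ := TopologicalSpace.isOpen_iUnion_countable
    (fun v : {v : F // 0 ≤ v} => {φ : range g | (φ : StrongDual ℝ F) v < 0})
    (fun v => isOpen_lt (((ContinuousLinearMap.apply ℝ ℝ (v : F)).continuous).comp
      continuous_subtype_val) continuous_const)
  filter_upwards [hfg, (ae_ball_iff hT).2 fun v _ => h v v.2] with ω hω hpos v hv
  by_contra! hneg
  rw [hω] at hneg hpos
  have hmem : (⟨g ω, mem_range_self ω⟩ : range g) ∈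
      ⋃ v : {v : F // 0 ≤ v}, {φ : range g | (φ : StrongDual ℝ F) v < 0} :=
    mem_iUnion.2 ⟨⟨v, hv⟩, hneg⟩
  rw [← hcover] at hmem
  simp only [mem_iUnion] at hmem
  obtain ⟨w, hw, hlt⟩ := hmem
  exact absurd (hpos w hw) (not_le.2 hlt)

/-! ### Positivity of the operator and of its multiplier -/

section Positivity

variable {Ω : Type*} [MeasurableSpace Ω] {μ : Measure Ω} {F : Type*} [NormedAddCommGroup F]
  [NormedSpace ℝ F] [Lattice F] {p : ℝ≥0∞} [Fact (1 ≤ p)]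
  {T : Lp (StrongDual ℝ F) p μ →L[ℝ] Lp (StrongDual ℝ F) p μ}
  {M : Ω → StrongDual ℝ F →L[ℝ] StrongDual ℝ F}

theorem IsPositiveMultiplier.isPositiveLpOperator (h : IsPositiveMultiplier μ M)
    (hTM : IsMultiplicationOperator M T) : IsPositiveLpOperator T := by
  obtain ⟨N, -, hNM, hN⟩ := h
  intro f hf
  refine (Lp.aestronglyMeasurable (T f)).ae_isPositiveFunctional fun v hv => ?_
  have heq := (Lp.aestronglyMeasurable f).ae_clm_apply_eq
    (S := fun ω => (ContinuousLinearMap.apply ℝ ℝ v).comp (N ω))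
    (S' := fun ω => (ContinuousLinearMap.apply ℝ ℝ v).comp (M ω))
    fun φ => sigmaStarEquiv_iff.1 hNM _ (simpleTensor_mem_projTensor φ v)
  filter_upwards [hf, hTM f v, heq] with ω h1 h2 h3
  rw [h2]
  exact (hN ω _ h1 v hv).trans_eq h3

/-- The constant `φ` need not lie in `L^p`, so `T` is tested on its restriction to each piece of
finite measure. -/
theorem IsPositiveLpOperator.ae_nonneg [μ.IsComplete] (hμ : IsStrictlyLocalizable μ)
    (hT : IsPositiveLpOperator T) (hTM : IsMultiplicationOperator M T) {φ : StrongDual ℝ F}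
    (hφ : IsPositiveFunctional φ) {v : F} (hv : 0 ≤ v) : ∀ᵐ ω ∂μ, 0 ≤ M ω φ v := by
  obtain ⟨𝒜, hA, -, hnull⟩ := hμ.exists_pieces
  refine hnull _ fun A hA' => ?_
  obtain ⟨mA, fA⟩ := hA A hA'
  have hind := indicatorConstLp_coeFn (p := p) (hs := mA) (hμs := fA.ne) (c := φ)
  have hpos := hT (indicatorConstLp p mA fA.ne φ) (by
    filter_upwards [hind] with ω hω
    rw [hω]
    by_cases h : ω ∈ A
    · simpa [h] using hφ
    · rw [indicator_of_notMem h]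
      exact fun _ _ => le_rfl)
  have key : ∀ᵐ ω ∂μ, ω ∈ A → 0 ≤ M ω φ v := by
    filter_upwards [hind, hpos, hTM (indicatorConstLp p mA fA.ne φ) v] with ω h1 h2 h3 hω
    have := h2 v hv
    rwa [h3, h1, indicator_of_mem hω] at this
  refine measure_mono_null ?_ key
  exact fun ω hω h => hω.1 (h hω.2)

theorem IsPositiveLpOperator.isPositiveMultiplier [μ.IsComplete] (hμ : IsStrictlyLocalizable μ)
    (hT : IsPositiveLpOperator T) (hM : MemSigmaStar (projTensor F) μ M)
    (hTM : IsMultiplicationOperator M T) : IsPositiveMultiplier μ M := by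
  suffices H : ∃ N : Ω → StrongDual ℝ F →L[ℝ] StrongDual ℝ F,
      (∀ φ v, (fun ω => N ω φ v) =ᵐ[μ] fun ω => M ω φ v) ∧ ∀ ω, IsPositiveOperator (N ω) by
    obtain ⟨N, hNM, hN⟩ := H
    have h := ae_eq_of_mem_projTensor hNM
    exact ⟨N, hM.congr h, sigmaStarEquiv_iff.2 h, hN⟩
  -- For `μ = 0` on a nonempty `Ω` positivity would force `ρ 1 = 0`, so there is no lifting; `N = 0`
  -- serves.
  rcases eq_or_ne μ 0 with rfl | h0
  · exact ⟨0, fun φ v => by simp [Filter.EventuallyEq], fun ω φ _ v _ => le_rfl⟩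
  obtain ⟨ρ, hρ⟩ := hμ.exists_isLinearLifting h0
  obtain ⟨N, hN⟩ := exists_lift_of_isLinearLifting hρ hM
  have mM : ∀ φ v, Measurable fun ω => M ω φ v := fun φ v =>
    hM.measurable _ (simpleTensor_mem_projTensor φ v)
  obtain ⟨K, hK⟩ := exists_bound_of_memSigmaStar hM
  refine ⟨N, fun φ v => ?_, fun ω φ hφ v hv => ?_⟩
  · simp only [hN]
    exact hρ.ae_eq _ (mM φ v) ⟨_, hK φ v⟩
  · rw [hN]
    exact hρ.nonneg _ (mM φ v) ⟨_, hK φ v⟩ (hT.ae_nonneg hμ hTM hφ hv) ω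

end Positivity

theorem mainTheorem7 {Ω : Type*} [MeasurableSpace Ω] (μ : Measure Ω) [μ.IsComplete]
    (hμ : IsStrictlyLocalizable μ)
    {F : Type*} [NormedAddCommGroup F] [NormedSpace ℝ F] [CompleteSpace F]
    [Lattice F] [IsOrderedAddMonoid F] [IsOrderedModule ℝ F] [HasSolidNorm F]
    (p : ℝ≥0∞) [Fact (1 ≤ p)]
    (T : Lp (StrongDual ℝ F) p μ →L[ℝ] Lp (StrongDual ℝ F) p μ) (hT : IsLocalOperator T)
    (M : Ω → StrongDual ℝ F →L[ℝ] StrongDual ℝ F) (hM : MemSigmaStar (projTensor F) μ M)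
    (hTM : IsMultiplicationOperator M T) :
    IsPositiveLpOperator T ↔ IsPositiveMultiplier μ M :=
  ⟨fun h => h.isPositiveMultiplier hμ hM hTM, fun h => h.isPositiveLpOperator hTM⟩
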